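/- Let $d\ge 1$ and let $I_1,\dots,I_d$ be pairwise disjoint parallel segments of unit length in the plane. A \emph{$d$-interval} is a set $J\subseteq\bigcup_{i=1}^d I_i$ such that each intersection $J\cap I_i$ is a closed interval (possibly a single point, possibly empty). Let $k=\lceil\log_2(d+2)\rceil$, and let $\mathcal F$ be a (finite or infinite) family of $d$-intervals such that any $k$ or fewer (but at least one) members of $\mathcal F$ have a common point. Then $\mathcal F$ can be pierced by a multipoint: there are points $x_i\in I_i$, one for each $i=1,\dots,d$, such that every $J\in\mathcal F$ contains at least one of $x_1,\dots,x_d$. -/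

import Mathlib

/-- The Euclidean plane. -/
abbrev Plane : Type := EuclideanSpace ℝ (Fin 2)

/-- `I` lists `d` pairwise disjoint parallel segments of unit length in the plane:
all of them are translates of the segment from `0` to one unit vector `u`. -/
structure AreParallelUnitSegments {d : ℕ} (I : Fin d → Set Plane) : Prop where
  parallel_unit : ∃ u : Plane, ‖u‖ = 1 ∧ ∀ i, ∃ p : Plane, I i = segment ℝ p (p + u)
  disjoint : ∀ i j, i ≠ j → Disjoint (I i) (I j)

/-- A closed (bounded) interval lying on some line of the plane.
One-point intervals (`a = b`) and the empty interval are included. -/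
def IsClosedInterval (S : Set Plane) : Prop :=
  S = ∅ ∨ ∃ a b : Plane, S = segment ℝ a b

/-- A `d`-interval over the segments `I 0, …, I (d - 1)`: a subset of their union that intersects
each of them in a closed interval. -/
structure IsDInterval {d : ℕ} (I : Fin d → Set Plane) (J : Set Plane) : Prop where
  subset_iUnion : J ⊆ ⋃ i, I i
  component : ∀ i, IsClosedInterval (J ∩ I i)

/-- The set `T` pierces `F` (is a transversal of `F`): it meets every member of `F`. -/
def Pierces (T : Set Plane) (F : Set (Set Plane)) : Prop :=
  ∀ J ∈ F, (J ∩ T).Nonempty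

/-- A multipoint: a subset of the union of the segments with exactly one point on each segment. -/
structure IsMultipoint {d : ℕ} (I : Fin d → Set Plane) (T : Set Plane) : Prop where
  subset_iUnion : T ⊆ ⋃ i, I i
  existsUnique : ∀ i, ∃! x : Plane, x ∈ T ∩ I i

/-! Parametrise each segment by [0, 1]. Take first a finite family. For a candidate multipoint x,
let ρ be the distance from x_i to the i-th component of J and φ the same distance signed by the side
on which the component lies (ρ = 1, φ = 0 if the component is empty). The field V_i(x) = ∑_J φ_{J,i}
∏_{l ≠ i} ρ_{J,l} points into the cube on its boundary, so it has a zero x (`poincare_miranda`). If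
x misses some J, this zero says that the vectors φ/ρ, weighted by ∏ ρ, balance to 0. An averaging
argument that repeatedly halves a set of coordinates then selects at most k members missed by x such
that for no i do all their i-th components lie strictly on the same side of x_i
(`exists_small_finset_of_balanced`). Their common point lies on some I_i and contradicts this.
Compactness of the cube handles infinite families.

Poincaré–Miranda follows from Kuhn's lemma. There, a discrete Stokes theorem shows that a grid map
respecting opposite faces sweeps the same signed volume as the identity, so some simplex has a
nondegenerate image. -/

/-! ### Discrete Stokes theorem on the Freudenthal triangulation. -/

open Equiv in
/-- The `j`-th vertex of the simplex of the Freudenthal triangulation with lowest vertex `q` whose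
edges run successively in the directions `π 0, π 1, …`. -/
def freudenthalVertex {d : ℕ} (q : Fin d → ℕ) (π : Perm (Fin d)) (j : Fin (d + 1)) : Fin d → ℕ :=
  fun a => q a + if (π⁻¹ a : Fin d).val < j.val then 1 else 0

theorem sum_perm_sign_mul_eq_zero {d : ℕ} (s : Equiv.Perm (Fin d))
    (hs : Equiv.Perm.sign s = -1) (G : Equiv.Perm (Fin d) → ℤ) (hG : ∀ π, G (π * s) = G π) :
    ∑ π : Equiv.Perm (Fin d), (Equiv.Perm.sign π : ℤ) * G π = 0 := by
  have h := Equiv.sum_comp (Equiv.mulRight s)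
    (fun π : Equiv.Perm (Fin d) => (Equiv.Perm.sign π : ℤ) * G π)
  simp only [Equiv.coe_mulRight, map_mul, hs, hG, Units.val_neg,
    mul_neg, mul_one, neg_mul, Finset.sum_neg_distrib] at h
  omega

/-- The shift trades the layer `p j = 0` for the layer `p j = n`, and neither contributes. -/
theorem sum_grid_shift {d : ℕ} (n : ℕ) (j : Fin d) (H : (Fin d → ℕ) → ℤ)
    (h0 : ∀ p, p j = 0 → H p = 0) (hn : ∀ p, p j = n → H p = 0) :
    ∑ q ∈ Fintype.piFinset (fun _ : Fin d => Finset.range n), H (q + Pi.single j 1) =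
      ∑ q ∈ Fintype.piFinset (fun _ : Fin d => Finset.range n), H q := by
  refine Finset.sum_bij_ne_zero (fun q _ _ => q + Pi.single j 1) ?_ ?_ ?_ ?_
  · intro q hq hne
    simp only [Fintype.mem_piFinset, Finset.mem_range] at hq ⊢
    intro a
    by_cases ha : a = j
    · subst ha
      have := hq a
      have h2 : (q + Pi.single a 1 : Fin d → ℕ) a ≠ n := fun h => hne (hn _ h)
      simp at h2 ⊢
      omega
    · simpa [Pi.single_eq_of_ne ha] using hq a
  · intro q _ _ q' _ _ h
    exact add_right_cancel h
  · intro b hb hne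
    have hbj : b j ≠ 0 := fun h => hne (h0 _ h)
    have hb' : Function.update b j (b j - 1) + Pi.single j 1 = b := by
      ext a
      by_cases ha : a = j
      · subst ha; simp; omega
      · simp [ha]
    refine ⟨Function.update b j (b j - 1), ?_, ?_, hb'⟩
    · simp only [Fintype.mem_piFinset, Finset.mem_range] at hb ⊢
      intro a
      by_cases ha : a = j
      · subst ha; have := hb a; simp; omega
      · simpa [ha] using hb a
    · rwa [hb']
  · intro q _ _; rfl

/-- Discrete Stokes theorem on the Freudenthal triangulation of a cube, for cochains that vanish on
the boundary. -/
theorem sum_coboundary_eq_zero {e : ℕ} (n : ℕ) (c : (Fin (e + 1) → Fin (e + 1) → ℕ) → ℤ)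
    (h0 : ∀ w j, (∀ i, w i j = 0) → c w = 0) (hn : ∀ w j, (∀ i, w i j = n) → c w = 0) :
    ∑ q ∈ Fintype.piFinset (fun _ : Fin (e + 1) => Finset.range n),
      ∑ π : Equiv.Perm (Fin (e + 1)), (Equiv.Perm.sign π : ℤ) *
        ∑ i : Fin (e + 2), (-1) ^ (i : ℕ) * c (fun j => freudenthalVertex q π (i.succAbove j)) =
      0 := by
  -- A facet omitting an intermediate vertex is shared by two simplices of the same cube, whose
  -- permutations differ by an adjacent transposition.
  have interior : ∀ (q : Fin (e + 1) → ℕ) (i : Fin e), ∑ π : Equiv.Perm (Fin (e + 1)),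
      (Equiv.Perm.sign π : ℤ) *
        c (fun j => freudenthalVertex q π (i.castSucc.succ.succAbove j)) = 0 := by
    intro q i
    refine sum_perm_sign_mul_eq_zero (Equiv.swap i.castSucc i.succ)
      (Equiv.Perm.sign_swap (by simp [Fin.ext_iff])) _ ?_
    intro π
    congr 1
    ext j a
    have hne : (i.castSucc.succ.succAbove j).val ≠ i.val + 1 := by
      have := Fin.succAbove_ne i.castSucc.succ j
      simpa [Fin.ext_iff] using this
    simp only [freudenthalVertex, mul_inv_rev, Equiv.swap_inv, Equiv.Perm.coe_mul,
      Function.comp_apply]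
    congr 1
    have : ((Equiv.swap i.castSucc i.succ (π⁻¹ a)).val < (i.castSucc.succ.succAbove j).val) ↔
        ((π⁻¹ a).val < (i.castSucc.succ.succAbove j).val) := by
      rw [Equiv.swap_apply_def]
      split_ifs with h1 h2
      · rw [h1]; simp only [Fin.val_succ, Fin.val_castSucc]; omega
      · rw [h2]; simp only [Fin.val_succ, Fin.val_castSucc]; omega
      · rfl
    simp only [this]
  -- The path from `p` along `π 1, …, π e`. It is the facet without lowest vertex of a simplex based
  -- one step back along `π 0`, and the facet without top vertex of the simplex at `p` with `π`
  -- rotated.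
  set facet : (Fin (e + 1) → ℕ) → Equiv.Perm (Fin (e + 1)) → Fin (e + 1) → Fin (e + 1) → ℕ :=
    fun p π j a => p a + if (π⁻¹ a).val ≠ 0 ∧ (π⁻¹ a).val ≤ j.val then 1 else 0 with hfacet
  have first : ∀ q π, (fun j => freudenthalVertex q π ((0 : Fin (e + 2)).succAbove j)) =
      facet (q + Pi.single (π 0) 1) π := by
    intro q π
    ext j a
    simp only [freudenthalVertex, hfacet, Fin.zero_succAbove, Fin.val_succ, Pi.add_apply]
    by_cases ha : a = π 0
    · subst ha; simp
    · have : (π⁻¹ a).val ≠ 0 := by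
        intro h
        apply ha
        have h' : π⁻¹ a = 0 := Fin.ext h
        rw [← h']; simp
      rw [Pi.single_eq_of_ne ha]
      simp only [add_zero, Nat.lt_succ_iff, this, ne_eq, not_false_eq_true, true_and]
  have last : ∀ q π, (fun j => freudenthalVertex q (π * finRotate (e + 1))
      ((Fin.last (e + 1)).succAbove j)) = facet q π := by
    intro q π
    ext j a
    simp only [freudenthalVertex, hfacet, Fin.succAbove_last, Fin.val_castSucc, mul_inv_rev,
      Equiv.Perm.coe_mul, Function.comp_apply]
    congr 1
    obtain ⟨b, hb⟩ : ∃ b, finRotate (e + 1) b = π⁻¹ a :=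
      ⟨_, Equiv.apply_symm_apply (finRotate (e + 1)) _⟩
    rw [← hb, Equiv.Perm.inv_def, Equiv.symm_apply_apply]
    have hj := j.isLt
    have hbl := b.isLt
    by_cases hbe : b.val = e
    · have : b = Fin.last e := Fin.ext hbe
      subst this
      rw [finRotate_last]
      simp
      omega
    · rw [coe_finRotate_of_ne_last (by intro h; apply hbe; rw [h]; rfl)]
      simp
  have lastsum : ∀ q, ∑ π : Equiv.Perm (Fin (e + 1)), (Equiv.Perm.sign π : ℤ) *
      ((-1) ^ (e + 1) * c (fun j => freudenthalVertex q π ((Fin.last (e + 1)).succAbove j))) =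
      - ∑ π : Equiv.Perm (Fin (e + 1)), (Equiv.Perm.sign π : ℤ) * c (facet q π) := by
    intro q
    rw [← Equiv.sum_comp (Equiv.mulRight (finRotate (e + 1))), ← Finset.sum_neg_distrib]
    refine Finset.sum_congr rfl fun π _ => ?_
    simp only [Equiv.coe_mulRight, last, map_mul, sign_finRotate]
    have : ((-1 : ℤ) ^ e) * (-1) ^ e = 1 := by rw [← mul_pow]; simp
    push_cast
    rw [pow_succ]
    linear_combination (-(Equiv.Perm.sign π : ℤ) * c (facet q π)) * this
  have split : ∀ q, ∑ π : Equiv.Perm (Fin (e + 1)), (Equiv.Perm.sign π : ℤ) *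
      ∑ i : Fin (e + 2), (-1) ^ (i : ℕ) * c (fun j => freudenthalVertex q π (i.succAbove j)) =
      ∑ π : Equiv.Perm (Fin (e + 1)), (Equiv.Perm.sign π : ℤ) *
        (c (facet (q + Pi.single (π 0) 1) π) - c (facet q π)) := by
    intro q
    have e1 : ∀ π : Equiv.Perm (Fin (e + 1)), (Equiv.Perm.sign π : ℤ) *
      ∑ i : Fin (e + 2), (-1) ^ (i : ℕ) * c (fun j => freudenthalVertex q π (i.succAbove j)) =
      (Equiv.Perm.sign π : ℤ) * c (facet (q + Pi.single (π 0) 1) π) +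
      ∑ i : Fin e, (-1) ^ (i.val + 1) * ((Equiv.Perm.sign π : ℤ) *
        c (fun j => freudenthalVertex q π (i.castSucc.succ.succAbove j))) +
      (Equiv.Perm.sign π : ℤ) * ((-1) ^ (e + 1) *
        c (fun j => freudenthalVertex q π ((Fin.last (e + 1)).succAbove j))) := by
      intro π
      rw [Fin.sum_univ_succ, Fin.sum_univ_castSucc, first, mul_add, mul_add, Finset.mul_sum,
        ← add_assoc]
      simp only [Fin.val_zero, pow_zero, one_mul, Fin.val_succ, Fin.val_castSucc, Fin.succ_last,
        Fin.val_last]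
      congr 2
      refine Finset.sum_congr rfl fun i _ => ?_
      ring
    rw [Finset.sum_congr rfl fun π _ => e1 π, Finset.sum_add_distrib, Finset.sum_add_distrib,
      lastsum, Finset.sum_comm]
    simp only [← Finset.mul_sum, interior, mul_zero, Finset.sum_const_zero, add_zero, mul_sub,
      Finset.sum_sub_distrib]
    ring
  rw [Finset.sum_congr rfl fun q _ => split q, Finset.sum_comm]
  refine Finset.sum_eq_zero fun π _ => ?_
  rw [← Finset.mul_sum, Finset.sum_sub_distrib,
    sum_grid_shift n (π 0) (fun p => c (facet p π)), sub_self, mul_zero]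
  · intro p hp
    exact h0 _ (π 0) fun i => by simp [hfacet, hp]
  · intro p hp
    exact hn _ (π 0) fun i => by simp [hfacet, hp]

/-! ### Signed volume of grid maps. -/

/-- A determinant with a row of ones, expanded along another row, is an alternating sum of terms
each of which does not involve one of the columns. -/
theorem sum_facet_eq_det {e : ℕ} (M : Matrix (Fin (e + 1)) (Fin (e + 1)) ℤ) (hM : ∀ j, M 0 j = 1)
    (r : Fin (e + 1)) (hr : r ≠ 0) :
    ∑ i : Fin (e + 1), (-1) ^ (i : ℕ) * ((∑ j : Fin e, M r (i.succAbove j)) *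
      (M.submatrix r.succAbove i.succAbove).det) = -(-1) ^ (r : ℕ) * M.det := by
  -- Replacing row `r` by ones duplicates row `0`, so the alternating sum of the minors vanishes;
  -- this kills the full row sum in `h2`.
  have h1 : (M.updateRow r (fun _ => 1)).det = 0 := by
    refine Matrix.det_zero_of_row_eq hr ?_
    ext j
    simp [Matrix.updateRow_ne hr.symm, hM]
  rw [Matrix.det_succ_row _ r] at h1
  simp only [Matrix.updateRow_self, mul_one, Matrix.submatrix_updateRow_succAbove] at h1
  rw [Matrix.det_succ_row M r]
  have h2 : ∀ i : Fin (e + 1), ∑ j : Fin e, M r (i.succAbove j) = (∑ j, M r j) - M r i := by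
    intro i
    rw [Fin.sum_univ_succAbove _ i]; ring
  have h3 : ((-1 : ℤ) ^ (r : ℕ)) * (-1) ^ (r : ℕ) = 1 := by rw [← mul_pow]; simp
  have h4 : ∑ i : Fin (e + 1), (-1) ^ (i : ℕ) * (M.submatrix r.succAbove i.succAbove).det = 0 := by
    have : (-1) ^ (r : ℕ) * ∑ i : Fin (e + 1),
        (-1) ^ (i : ℕ) * (M.submatrix r.succAbove i.succAbove).det = 0 := by
      rw [← h1, Finset.mul_sum]
      exact Finset.sum_congr rfl fun i _ => by rw [pow_add]; ring
    exact (mul_eq_zero.1 this).resolve_left (by positivity)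
  calc _ = (∑ j, M r j) * ∑ i : Fin (e + 1),
        (-1) ^ (i : ℕ) * (M.submatrix r.succAbove i.succAbove).det -
        ∑ i : Fin (e + 1), (-1) ^ (i : ℕ) * (M r i *
          (M.submatrix r.succAbove i.succAbove).det) := by
        rw [Finset.mul_sum, ← Finset.sum_sub_distrib]
        exact Finset.sum_congr rfl fun i _ => by rw [h2]; ring
    _ = _ := by
        rw [h4, mul_zero, zero_sub, ← Finset.sum_neg_distrib, Finset.mul_sum]
        refine Finset.sum_congr rfl fun i _ => ?_
        rw [pow_add]
        linear_combination ((-1) ^ (i : ℕ) * (M r i *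
          (M.submatrix r.succAbove i.succAbove).det)) * h3

/-- The matrix of the values of `1, f 0, f 1, …` at given points. -/
def affineMatrix {d m : ℕ} (f : Fin d → (Fin d → ℕ) → ℤ) (v : Fin m → Fin d → ℕ) :
    Matrix (Fin (d + 1)) (Fin m) ℤ :=
  Matrix.of fun r j => (Fin.cons (fun _ => 1) f : Fin (d + 1) → (Fin d → ℕ) → ℤ) r (v j)

theorem affineMatrix_zero {d m : ℕ} (f : Fin d → (Fin d → ℕ) → ℤ) (v : Fin m → Fin d → ℕ)
    (j : Fin m) : affineMatrix f v 0 j = 1 := rfl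

theorem affineMatrix_succ {d m : ℕ} (f : Fin d → (Fin d → ℕ) → ℤ) (v : Fin m → Fin d → ℕ)
    (k : Fin d) (j : Fin m) : affineMatrix f v k.succ j = f k (v j) := rfl

/-- `d!` times the signed volume swept by the piecewise affine extension of `f` to `[0, n]^d`. -/
def gridVolume {d : ℕ} (n : ℕ) (f : Fin d → (Fin d → ℕ) → ℤ) : ℤ :=
  ∑ q ∈ Fintype.piFinset (fun _ : Fin d => Finset.range n),
    ∑ π : Equiv.Perm (Fin d), (Equiv.Perm.sign π : ℤ) *
      (affineMatrix f (freudenthalVertex q π)).det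

theorem det_eq_zero_of_row_eq_mul {m : ℕ} (M : Matrix (Fin m) (Fin m) ℤ) {r s : Fin m}
    (h : r ≠ s) (a : ℤ) (hM : ∀ j, M r j = a * M s j) : M.det = 0 := by
  rw [← Matrix.det_updateRow_add_smul_self M h (-a)]
  refine Matrix.det_eq_zero_of_row_eq_zero r fun j => ?_
  simp [hM]

/-- The volume is, up to sign, the total coboundary of the cochain `c`. On a face of direction `m`
the factor `h` vanishes; on any other face a remaining row is a constant multiple of the row of
ones. -/
theorem gridVolume_update_eq_zero {d : ℕ} (n : ℕ) (f : Fin d → (Fin d → ℕ) → ℤ)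
    (h0 : ∀ k x, x k = 0 → f k x = 0) (hn : ∀ k x, x k = n → f k x = n)
    (m : Fin d) (h : (Fin d → ℕ) → ℤ) (hm0 : ∀ x, x m = 0 → h x = 0)
    (hmn : ∀ x, x m = n → h x = 0) : gridVolume n (Function.update f m h) = 0 := by
  obtain _ | e := d
  · exact m.elim0
  set g := Function.update f m h with hg
  set c : (Fin (e + 1) → Fin (e + 1) → ℕ) → ℤ := fun w =>
    (∑ j, h (w j)) * ((affineMatrix g w).submatrix m.succ.succAbove id).det with hc
  have key : ∀ (a : ℤ) (b : ℕ), (∀ k x, x k = b → f k x = a) → (∀ x, x m = b → h x = 0) →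
      ∀ w j, (∀ i, w i j = b) → c w = 0 := by
    intro a b hf hh w j hw
    by_cases hj : j = m
    · subst hj
      simp only [hc]
      rw [Finset.sum_eq_zero fun i _ => hh _ (hw i), zero_mul]
    · simp only [hc]
      obtain ⟨r, hr⟩ := Fin.exists_succAbove_eq (x := j.succ) (y := m.succ)
        (by simpa [Fin.succ_inj] using hj)
      obtain ⟨s, hs⟩ := Fin.exists_succAbove_eq (x := 0) (y := m.succ) (Fin.succ_ne_zero m).symm
      rw [det_eq_zero_of_row_eq_mul _ (r := r) (s := s) _ a, mul_zero]
      · intro i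
        simp [hr, hs, affineMatrix_zero, affineMatrix_succ, hg, hj, hf _ _ (hw i)]
      · rintro rfl
        rw [hr] at hs
        exact Fin.succ_ne_zero _ hs
  have stokes := sum_coboundary_eq_zero n c (key 0 0 h0 hm0) (key n n hn hmn)
  have hdet : ∀ q π, ∑ i : Fin (e + 2), (-1) ^ (i : ℕ) *
      c (fun j => freudenthalVertex q π (i.succAbove j)) =
      -(-1) ^ (m.succ : ℕ) * (affineMatrix g (freudenthalVertex q π)).det := by
    intro q π
    rw [← sum_facet_eq_det _ (fun j => by simp [affineMatrix]) m.succ (Fin.succ_ne_zero m)]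
    refine Finset.sum_congr rfl fun i _ => ?_
    have : ∀ x, affineMatrix g (freudenthalVertex q π) m.succ x = h (freudenthalVertex q π x) :=
      fun x => by simp [affineMatrix, hg]
    simp only [this, hc]
    rfl
  simp only [hdet] at stokes
  have : -(-1) ^ (m.succ : ℕ) * gridVolume n g = 0 := by
    rw [← stokes, gridVolume, Finset.mul_sum]
    refine Finset.sum_congr rfl fun q _ => ?_
    rw [Finset.mul_sum]
    exact Finset.sum_congr rfl fun π _ => by ring
  exact (mul_eq_zero.1 this).resolve_left (by simp)

theorem affineMatrix_update {d m : ℕ} (f : Fin d → (Fin d → ℕ) → ℤ) (k : Fin d)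
    (h : (Fin d → ℕ) → ℤ) (v : Fin m → Fin d → ℕ) :
    affineMatrix (Function.update f k h) v =
      (affineMatrix f v).updateRow k.succ (fun j => h (v j)) := by
  ext r j
  refine Fin.cases ?_ (fun r => ?_) r
  · rw [Matrix.updateRow_ne (Fin.succ_ne_zero k).symm]
    rfl
  · by_cases hr : r = k
    · subst hr; simp [affineMatrix]
    · simp [affineMatrix, hr]

theorem gridVolume_update_sub {d : ℕ} (n : ℕ) (f : Fin d → (Fin d → ℕ) → ℤ) (k : Fin d)
    (h h' : (Fin d → ℕ) → ℤ) : gridVolume n (Function.update f k (h - h')) =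
      gridVolume n (Function.update f k h) - gridVolume n (Function.update f k h') := by
  simp only [gridVolume, ← Finset.sum_sub_distrib, ← mul_sub, affineMatrix_update]
  refine Finset.sum_congr rfl fun q _ => Finset.sum_congr rfl fun π _ => ?_
  congr 1
  rw [eq_sub_iff_add_eq, ← Matrix.det_updateRow_add]
  congr 2
  ext j
  simp

/-- Coordinates are exchanged one at a time: the volume is linear in each, and the difference of two
admissible coordinates vanishes on both of its faces. -/
theorem gridVolume_eq_of_boundary {d : ℕ} (n : ℕ) (f : Fin d → (Fin d → ℕ) → ℤ)
    (h0 : ∀ k x, x k = 0 → f k x = 0) (hn : ∀ k x, x k = n → f k x = n) (s : Finset (Fin d)) :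
    ∀ g : Fin d → (Fin d → ℕ) → ℤ, (∀ k x, x k = 0 → g k x = 0) → (∀ k x, x k = n → g k x = n) →
      (∀ k ∉ s, g k = f k) → gridVolume n g = gridVolume n f := by
  induction s using Finset.induction_on with
  | empty =>
    intro g _ _ h
    rw [funext fun k => h k (Finset.notMem_empty k)]
  | insert m s hm ih =>
    intro g g0 gn h
    rw [← ih (Function.update g m (f m))]
    · have := gridVolume_update_eq_zero n g g0 gn m (g m - f m)
        (fun x hx => by simp [g0 _ _ hx, h0 _ _ hx]) (fun x hx => by simp [gn _ _ hx, hn _ _ hx])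
      rw [gridVolume_update_sub, Function.update_eq_self] at this
      exact sub_eq_zero.1 this
    · intro k x hx
      by_cases hk : k = m
      · subst hk; simp [h0 _ _ hx]
      · simp [hk, g0 _ _ hx]
    · intro k x hx
      by_cases hk : k = m
      · subst hk; simp [hn _ _ hx]
      · simp [hk, gn _ _ hx]
    · intro k hk
      by_cases hkm : k = m
      · subst hkm; simp
      · simp [hkm, h k (by simp [hk, hkm])]

theorem gridVolume_coord {d : ℕ} (n : ℕ) :
    gridVolume n (fun (k : Fin d) x => (x k : ℤ)) = n ^ d * d.factorial := by
  have hdet : ∀ (q : Fin d → ℕ) (π : Equiv.Perm (Fin d)),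
      (affineMatrix (fun (k : Fin d) x => (x k : ℤ)) (freudenthalVertex q π)).det =
        Equiv.Perm.sign π := by
    intro q π
    set A := affineMatrix (fun (k : Fin d) x => (x k : ℤ)) (freudenthalVertex q π) with hA
    rw [Matrix.det_eq_of_forall_col_eq_smul_add_pred (A := A)
      (B := Matrix.of fun i => Fin.cons (A i 0) fun j => A i j.succ - A i j.castSucc)
      (fun _ => 1) (fun i => by simp) (fun i j => by simp)]
    rw [Matrix.det_succ_row_zero, Fin.sum_univ_succ, Finset.sum_eq_zero]
    · have : (Matrix.of fun i => (Fin.cons (A i 0) fun j => A i j.succ - A i j.castSucc :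
          Fin (d + 1) → ℤ)).submatrix Fin.succ (Fin.succAbove 0) =
          (π⁻¹).permMatrix ℤ := by
        ext i j
        simp only [Matrix.submatrix_apply, Fin.zero_succAbove, Matrix.of_apply, Fin.cons_succ, hA,
          affineMatrix, freudenthalVertex, Fin.val_succ, Fin.val_castSucc,
          Equiv.Perm.permMatrix, PEquiv.toMatrix_apply, Equiv.toPEquiv_apply, Option.mem_some_iff,
          Fin.ext_iff]
        push_cast
        split_ifs <;> omega
      rw [this, Matrix.det_permutation]
      simp [hA, affineMatrix]
    · intro j _
      simp [hA, affineMatrix]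
  simp only [gridVolume, hdet]
  have : ∀ π : Equiv.Perm (Fin d), (Equiv.Perm.sign π : ℤ) * Equiv.Perm.sign π = 1 := fun π => by
    rw [← Units.val_mul, Int.units_mul_self, Units.val_one]
  simp [this, Fintype.card_perm]

/-! ### Kuhn's lemma and the Poincaré–Miranda theorem. -/

/-- Kuhn's cubical Sperner lemma. -/
theorem exists_cube_of_labels {d : ℕ} {n : ℕ} (hn : 0 < n) (L : Fin d → (Fin d → ℕ) → Prop)
    (h0 : ∀ k x, x k = 0 → L k x) (h1 : ∀ k x, x k = n → ¬ L k x) :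
    ∃ q : Fin d → ℕ, (∀ a, q a < n) ∧ ∀ k, ∃ y z : Fin d → ℕ,
      (∀ a, q a ≤ y a ∧ y a ≤ q a + 1) ∧ (∀ a, q a ≤ z a ∧ z a ≤ q a + 1) ∧ L k y ∧ ¬ L k z := by
  classical
  -- A label constant on a simplex makes its row a multiple of the row of ones, so a simplex with
  -- nonzero determinant sees both values of every label.
  set f : Fin d → (Fin d → ℕ) → ℤ := fun k x => if L k x then 0 else n with hf
  have hvol : gridVolume n f ≠ 0 := by
    rw [← gridVolume_eq_of_boundary n f (fun k x hx => by simp [hf, h0 k x hx])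
      (fun k x hx => by simp [hf, h1 k x hx]) Finset.univ (fun k x => (x k : ℤ))
      (fun k x hx => by simp [hx]) (fun k x hx => by simp [hx]) (by simp), gridVolume_coord]
    positivity
  obtain ⟨q, hq, hq'⟩ := Finset.exists_ne_zero_of_sum_ne_zero hvol
  obtain ⟨π, -, hπ⟩ := Finset.exists_ne_zero_of_sum_ne_zero hq'
  simp only [Fintype.mem_piFinset, Finset.mem_range] at hq
  have hdet := right_ne_zero_of_mul hπ
  refine ⟨q, hq, fun k => ?_⟩
  have hv : ∀ j a, q a ≤ freudenthalVertex q π j a ∧ freudenthalVertex q π j a ≤ q a + 1 := by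
    intro j a
    simp only [freudenthalVertex]
    split_ifs <;> omega
  have hy : ∃ j, L k (freudenthalVertex q π j) := by
    by_contra! hcon
    refine hdet (det_eq_zero_of_row_eq_mul _ (Fin.succ_ne_zero k) n fun j => ?_)
    simp [affineMatrix, hf, hcon j]
  have hz : ∃ j, ¬ L k (freudenthalVertex q π j) := by
    by_contra! hcon
    refine hdet (det_eq_zero_of_row_eq_mul _ (Fin.succ_ne_zero k) 0 fun j => ?_)
    simp [affineMatrix, hf, hcon j]
  obtain ⟨j, hj⟩ := hy
  obtain ⟨j', hj'⟩ := hz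
  exact ⟨_, _, hv j, hv j', hj, hj'⟩

open Filter Topology in
/-- The Poincaré–Miranda theorem. -/
theorem poincare_miranda {d : ℕ} (V : (Fin d → ℝ) → Fin d → ℝ) (hV : Continuous V)
    (h0 : ∀ x ∈ Set.Icc (0 : Fin d → ℝ) 1, ∀ i, x i = 0 → 0 ≤ V x i)
    (h1 : ∀ x ∈ Set.Icc (0 : Fin d → ℝ) 1, ∀ i, x i = 1 → V x i ≤ 0) :
    ∃ x ∈ Set.Icc (0 : Fin d → ℝ) 1, V x = 0 := by
  set P : ℕ → (Fin d → ℕ) → Fin d → ℝ := fun n x a => (x a : ℝ) / (n + 1) with hP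
  have hPmem : ∀ n x, (∀ a, x a ≤ n + 1) → P n x ∈ Set.Icc (0 : Fin d → ℝ) 1 := by
    intro n x hx
    refine ⟨fun a => by simp only [hP, Pi.zero_apply]; positivity, fun a => ?_⟩
    simp only [hP, Pi.one_apply]
    rw [div_le_one (by positivity)]
    exact_mod_cast hx a
  have step : ∀ n : ℕ, ∃ q : Fin d → ℕ, (∀ a, q a ≤ n + 1) ∧ ∀ k, ∃ y z : Fin d → ℕ,
      (∀ a, q a ≤ y a ∧ y a ≤ q a + 1) ∧ (∀ a, q a ≤ z a ∧ z a ≤ q a + 1) ∧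
      0 ≤ V (P n y) k ∧ V (P n z) k ≤ 0 := by
    intro n
    obtain ⟨q, hq, h⟩ := exists_cube_of_labels (d := d) (n := n + 1) n.succ_pos
      -- The label is the sign of `V`, overridden on the two faces, where `h0` and `h1` supply the
      -- weak inequalities.
      (fun k x => x k = 0 ∨ (x k ≠ n + 1 ∧ 0 < V (P n x) k)) (fun k x hx => Or.inl hx)
      (fun k x hx => by simp [hx])
    refine ⟨q, fun a => (hq a).le, fun k => ?_⟩
    obtain ⟨y, z, hy, hz, hLy, hLz⟩ := h k
    refine ⟨y, z, hy, hz, ?_, ?_⟩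
    · rcases hLy with h | h
      · refine h0 _ (hPmem n y fun a => ?_) k (by simp [hP, h])
        have := hy a; have := hq a; omega
      · exact h.2.le
    · push Not at hLz
      by_cases hzn : z k = n + 1
      · refine h1 _ (hPmem n z fun a => ?_) k ?_
        · have := hz a; have := hq a; omega
        · simp only [hP, hzn]
          push_cast
          exact div_self (by positivity)
      · exact hLz.2 hzn
  choose q hq y z hy hz hVy hVz using step
  obtain ⟨x, hx, φ, hφ, hlim⟩ := (isCompact_Icc (a := (0 : Fin d → ℝ)) (b := 1)).tendsto_subseq
    (fun n => hPmem n (q n) (hq n))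
  have hinv : Tendsto (fun n : ℕ => 1 / ((φ n : ℝ) + 1)) atTop (𝓝 0) :=
    tendsto_one_div_add_atTop_nhds_zero_nat.comp hφ.tendsto_atTop
  have near : ∀ w : ℕ → Fin d → ℕ, (∀ n a, q n a ≤ w n a ∧ w n a ≤ q n a + 1) →
      Tendsto (fun n => P (φ n) (w (φ n))) atTop (𝓝 x) := by
    intro w hw
    rw [tendsto_pi_nhds] at hlim ⊢
    intro a
    refine tendsto_of_tendsto_of_tendsto_of_le_of_le (hlim a)
      (by simpa using (hlim a).add hinv) (fun n => ?_) (fun n => ?_)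
    · simp only [hP, Function.comp_apply]
      gcongr
      exact (hw _ a).1
    · simp only [hP]
      rw [inv_eq_one_div, ← add_div]
      gcongr
      exact_mod_cast (hw _ a).2
  refine ⟨x, hx, funext fun k => le_antisymm ?_ ?_⟩
  · have := ((continuous_apply k).comp hV).continuousAt.tendsto.comp
      (near (fun n => z n k) (fun n => hz n k))
    exact le_of_tendsto' this fun n => hVz _ k
  · have := ((continuous_apply k).comp hV).continuousAt.tendsto.comp
      (near (fun n => y n k) (fun n => hy n k))
    exact ge_of_tendsto' this fun n => hVy _ k

/-! ### Small subfamilies of balanced vectors. -/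

/-- Greedy choice until `S` is empty. Since the halving is strict, it is `S.card + 1` that at least
halves at each step. -/
theorem exists_finset_of_halving {ι α : Type*} [DecidableEq ι] [DecidableEq α] (p : ι → Prop)
    (T : ι → Finset α) (j₀ : ι) (hj₀ : p j₀)
    (h : ∀ S ⊆ T j₀, S.Nonempty → ∃ j, p j ∧ 2 * (S ∩ T j).card < S.card) (m : ℕ) :
    ∃ (G : Finset ι) (S : Finset α), S ⊆ T j₀ ∧ j₀ ∈ G ∧ (∀ j ∈ G, p j) ∧ G.card ≤ m + 1 ∧
      (∀ a, (∀ j ∈ G, a ∈ T j) → a ∈ S) ∧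
      (S.Nonempty → (S.card + 1) * 2 ^ m ≤ (T j₀).card + 1) := by
  induction m with
  | zero =>
    exact ⟨{j₀}, T j₀, subset_rfl, by simp, by simpa using hj₀, by simp, by simp, by simp⟩
  | succ m ih =>
    obtain ⟨G, S, hS, hG, hp, hcard, hmem, hle⟩ := ih
    rcases S.eq_empty_or_nonempty with rfl | hne
    · exact ⟨G, ∅, hS, hG, hp, by omega, hmem, by simp⟩
    · obtain ⟨j, hj, hlt⟩ := h S hS hne
      refine ⟨insert j G, S ∩ T j, Finset.inter_subset_left.trans hS, Finset.mem_insert_of_mem hG,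
        ?_, (Finset.card_insert_le j G).trans (Nat.succ_le_succ hcard), ?_, fun _ => ?_⟩
      · simpa using ⟨hj, hp⟩
      · intro a ha
        simp only [Finset.mem_insert, forall_eq_or_imp] at ha
        exact Finset.mem_inter.2 ⟨hmem a ha.2, ha.1⟩
      · calc ((S ∩ T j).card + 1) * 2 ^ (m + 1) = (2 * (S ∩ T j).card + 2) * 2 ^ m := by ring
          _ ≤ (S.card + 1) * 2 ^ m := Nat.mul_le_mul_right _ (by omega)
          _ ≤ _ := hle hne

/-- If a positive combination of vectors in `[-1, 1]^d` vanishes, then few of these vectors already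
have the property that no coordinate is constantly `1` or constantly `-1` on them. -/
theorem exists_small_finset_of_balanced {ι : Type*} [Fintype ι] {d k : ℕ} (hk : d + 2 ≤ 2 ^ k)
    (w : ι → ℝ) (s : ι → Fin d → ℝ) (hw : ∀ j, 0 ≤ w j) (hpos : 0 < ∑ j, w j)
    (hs : ∀ j i, |s j i| ≤ 1) (h0 : ∀ i, ∑ j, w j * s j i = 0) :
    ∃ G : Finset ι, G.Nonempty ∧ G.card ≤ k ∧ (∀ j ∈ G, 0 < w j) ∧
      ∀ i ε, ε * ε = 1 → ¬ ∀ j ∈ G, s j i = ε := by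
  classical
  obtain ⟨j₀, -, hj₀⟩ := Finset.exists_ne_zero_of_sum_ne_zero hpos.ne'
  have hj₀ : 0 < w j₀ := lt_of_le_of_ne (hw j₀) hj₀.symm
  -- For numbers in [-1, 1], product `1` means that both are `1` or both are `-1`.
  set T : ι → Finset (Fin d) := fun j => Finset.univ.filter fun i => s j₀ i * s j i = 1 with hT
  have halving : ∀ S ⊆ T j₀, S.Nonempty → ∃ j, 0 < w j ∧ 2 * (S ∩ T j).card < S.card := by
    intro S hS hne
    by_contra! hcon
    have hcard : ∀ j, 2 * ((S ∩ T j).card : ℝ) ≤ ∑ i ∈ S, (1 + s j₀ i * s j i) := by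
      intro j
      have : S ∩ T j = S.filter fun i => s j₀ i * s j i = 1 := by ext i; simp [hT]
      rw [this, Finset.card_filter, Nat.cast_sum, Finset.mul_sum]
      refine Finset.sum_le_sum fun i _ => ?_
      split_ifs with h
      · rw [h]; norm_num
      · have : |s j₀ i * s j i| ≤ 1 := by
          rw [abs_mul]
          exact mul_le_one₀ (hs _ _) (abs_nonneg _) (hs _ _)
        have := (abs_le.1 this).1
        push_cast
        linarith
    have hle : ∀ j, w j * S.card ≤ w j * (2 * ((S ∩ T j).card : ℝ)) := by
      intro j
      rcases (hw j).eq_or_lt with h | h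
      · simp [← h]
      · exact mul_le_mul_of_nonneg_left (by exact_mod_cast hcon j h) h.le
    have hlt : w j₀ * S.card < w j₀ * (2 * ((S ∩ T j₀).card : ℝ)) := by
      rw [Finset.inter_eq_left.2 hS]
      have : (0 : ℝ) < S.card := by exact_mod_cast hne.card_pos
      exact mul_lt_mul_of_pos_left (by linarith) hj₀
    -- By balance, the `w`-average of `2 * (S ∩ T j).card` is at most `S.card`; strictness comes
    -- from `j₀`, where `S ∩ T j₀ = S`.
    have h1 : ∑ j, w j * S.card < ∑ j, w j * (2 * ((S ∩ T j).card : ℝ)) :=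
      Finset.sum_lt_sum (fun j _ => hle j) ⟨j₀, Finset.mem_univ _, hlt⟩
    have h2 : ∑ j, w j * (2 * ((S ∩ T j).card : ℝ)) ≤ ∑ j, w j * S.card := by
      calc _ ≤ ∑ j, w j * ∑ i ∈ S, (1 + s j₀ i * s j i) :=
            Finset.sum_le_sum fun j _ => mul_le_mul_of_nonneg_left (hcard j) (hw j)
        _ = ∑ j, w j * S.card + ∑ i ∈ S, s j₀ i * ∑ j, w j * s j i := by
            simp only [Finset.sum_add_distrib, Finset.sum_const, nsmul_eq_mul, mul_one, mul_add,
              Finset.mul_sum]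
            rw [Finset.sum_comm]
            congr 1
            exact Finset.sum_congr rfl fun i _ => Finset.sum_congr rfl fun j _ => by ring
        _ = _ := by simp [h0]
    exact absurd h1 (not_lt.2 h2)
  have hk0 : k ≠ 0 := by rintro rfl; simp at hk
  obtain ⟨G, S, hS, hG, hp, hcard, hmem, hle⟩ :=
    -- One of the `k` places is taken by `j₀`. A surviving coordinate would give `2 ^ k ≤ d + 1`.
    exists_finset_of_halving (fun j => 0 < w j) T j₀ hj₀ halving (k - 1)
  refine ⟨G, ⟨j₀, hG⟩, by omega, hp, fun i ε hε hall => ?_⟩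
  have hi : i ∈ S := hmem i fun j hj => by simp [hT, hall j hj, hall j₀ hG, hε]
  have hle := hle ⟨i, hi⟩
  have hS1 : 1 ≤ S.card := Finset.card_pos.2 ⟨i, hi⟩
  have hTd : (T j₀).card ≤ d := by simpa using Finset.card_le_univ (T j₀)
  have : 2 ^ k ≤ (S.card + 1) * 2 ^ (k - 1) := by
    obtain ⟨m, rfl⟩ := Nat.exists_eq_succ_of_ne_zero hk0
    rw [Nat.succ_sub_one, Nat.pow_succ, mul_comm]
    gcongr
    omega
  omega

/-! ### Piercing over `d` copies of the unit interval. -/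

/-- A signed and an unsigned weight that record the position of a point relative to a compact
interval, which may be empty. -/
theorem exists_signed_weight (A : Set ℝ) (hc : IsCompact A) (hconv : Convex ℝ A)
    (hA : A ⊆ Set.Icc 0 1) :
    ∃ ρ φ : ℝ → ℝ, Continuous ρ ∧ Continuous φ ∧ (∀ x, |φ x| ≤ ρ x) ∧ 0 ≤ φ 0 ∧ φ 1 ≤ 0 ∧
      (∀ x, ρ x = 0 ↔ x ∈ A) ∧ (∀ t ∈ A, ∀ x, x < t → φ x = ρ x) ∧
      ∀ t ∈ A, ∀ x, t < x → φ x = -ρ x := by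
  rcases A.eq_empty_or_nonempty with rfl | hne
  · exact ⟨fun _ => 1, fun _ => 0, continuous_const, continuous_const, by simp, le_rfl, le_rfl,
      by simp, by simp, by simp⟩
  · have hIcc := eq_Icc_of_connected_compact ⟨hne, hconv.isPreconnected⟩ hc
    have ha := hA (hc.sInf_mem hne)
    have hb := hA (hc.sSup_mem hne)
    have hab : sInf A ≤ sSup A := Real.sInf_le_sSup A hc.bddBelow hc.bddAbove
    generalize sInf A = a at *
    generalize sSup A = b at *
    subst hIcc
    have hcont : Continuous fun x : ℝ => max (a - x) 0 + min (b - x) 0 := by fun_prop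
    refine ⟨fun x => |max (a - x) 0 + min (b - x) 0|, fun x => max (a - x) 0 + min (b - x) 0,
      hcont.abs, hcont, fun x => le_rfl, ?_, ?_, fun x => ?_, fun t ht x hx => ?_,
      fun t ht x hx => ?_⟩
    · dsimp only
      rw [min_eq_right (by linarith [hb.1])]
      simp
    · dsimp only
      rw [max_eq_right (by linarith [ha.2])]
      simp
    · rw [abs_eq_zero, Set.mem_Icc]
      rcases le_total a x with h | h <;> rcases le_total x b with h' | h'
      · rw [max_eq_right (by linarith), min_eq_right (by linarith)]
        simp [h, h']
      · rw [max_eq_right (by linarith), min_eq_left (by linarith)]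
        constructor
        · intro h; constructor <;> linarith
        · intro h; linarith
      · rw [max_eq_left (by linarith), min_eq_right (by linarith)]
        constructor
        · intro h; constructor <;> linarith
        · intro h; linarith
      · obtain rfl : x = a := by linarith
        obtain rfl : x = b := by linarith
        simp
    · dsimp only
      rw [min_eq_right (by linarith [ht.2]), add_zero, abs_of_nonneg (le_max_right _ _)]
    · dsimp only
      rw [max_eq_right (by linarith [ht.1]), zero_add, abs_of_nonpos (min_le_right _ _), neg_neg]

theorem exists_pierce_of_fintype {ι : Type*} [Fintype ι] {d k : ℕ} (hk : d + 2 ≤ 2 ^ k)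
    (A : ι → Fin d → Set ℝ) (hc : ∀ j i, IsCompact (A j i)) (hconv : ∀ j i, Convex ℝ (A j i))
    (hA : ∀ j i, A j i ⊆ Set.Icc 0 1)
    (hint : ∀ G : Finset ι, G.Nonempty → G.card ≤ k → ∃ i t, ∀ j ∈ G, t ∈ A j i) :
    ∃ x ∈ Set.Icc (0 : Fin d → ℝ) 1, ∀ j, ∃ i, x i ∈ A j i := by
  classical
  by_contra! hcon
  choose ρ φ hρ hφ hle hφ0 hφ1 hzero hlt hgt using
    fun j i => exists_signed_weight (A j i) (hc j i) (hconv j i) (hA j i)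
  have hρ0 : ∀ j i x, 0 ≤ ρ j i x := fun j i x => (abs_nonneg _).trans (hle j i x)
  -- Multiplying `φ / ρ` by the full product of the `ρ` clears the denominator, which keeps `V`
  -- continuous.
  set V : (Fin d → ℝ) → Fin d → ℝ := fun x i =>
    ∑ j, φ j i (x i) * ∏ l ∈ Finset.univ.erase i, ρ j l (x l) with hV
  obtain ⟨x, hx, hVx⟩ := poincare_miranda V (by fun_prop)
    (fun x _ i hxi => Finset.sum_nonneg fun j _ =>
      mul_nonneg (by rw [hxi]; exact hφ0 j i) (Finset.prod_nonneg fun l _ => hρ0 _ _ _))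
    (fun x _ i hxi => Finset.sum_nonpos fun j _ =>
      mul_nonpos_of_nonpos_of_nonneg (by rw [hxi]; exact hφ1 j i)
        (Finset.prod_nonneg fun l _ => hρ0 _ _ _))
  obtain ⟨j₀, hj₀⟩ := hcon x hx
  have hw : ∀ j, 0 ≤ ∏ l, ρ j l (x l) := fun j => Finset.prod_nonneg fun l _ => hρ0 _ _ _
  obtain ⟨G, hG, hGk, hGpos, hGε⟩ := exists_small_finset_of_balanced hk
    (fun j => ∏ l, ρ j l (x l)) (fun j i => φ j i (x i) / ρ j i (x i)) hw
    (Finset.sum_pos' (fun j _ => hw j) ⟨j₀, Finset.mem_univ _, Finset.prod_pos fun l _ =>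
      lt_of_le_of_ne (hρ0 _ _ _) fun h => hj₀ l ((hzero _ _ _).1 h.symm)⟩)
    (fun j i => by
      rw [abs_div, abs_of_nonneg (hρ0 j i _)]
      exact div_le_one_of_le₀ (hle _ _ _) (hρ0 _ _ _))
    (fun i => by
      refine Eq.trans ?_ (congrFun hVx i)
      refine Finset.sum_congr rfl fun j _ => ?_
      rw [← Finset.mul_prod_erase _ _ (Finset.mem_univ i)]
      by_cases h : ρ j i (x i) = 0
      · have : φ j i (x i) = 0 := abs_nonpos_iff.1 (h ▸ hle j i (x i))
        simp [h, this]
      · field_simp)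
  obtain ⟨i, t, ht⟩ := hint G hG hGk
  have hne : ∀ j ∈ G, ρ j i (x i) ≠ 0 := fun j hj =>
    Finset.prod_ne_zero_iff.1 (hGpos j hj).ne' i (Finset.mem_univ i)
  rcases lt_trichotomy (x i) t with h | h | h
  · exact hGε i 1 (by norm_num) fun j hj => by
      rw [hlt j i t (ht j hj) _ h, div_self (hne j hj)]
  · obtain ⟨j, hj⟩ := hG
    exact hne j hj ((hzero _ _ _).2 (h ▸ ht j hj))
  · exact hGε i (-1) (by norm_num) fun j hj => by
      rw [hgt j i t (ht j hj) _ h, neg_div, div_self (hne j hj)]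

/-- The points of the cube piercing a given member form a closed set, so the finite case and
compactness suffice. -/
theorem exists_pierce {ι : Type*} {d k : ℕ} (hk : d + 2 ≤ 2 ^ k)
    (A : ι → Fin d → Set ℝ) (hc : ∀ j i, IsCompact (A j i)) (hconv : ∀ j i, Convex ℝ (A j i))
    (hA : ∀ j i, A j i ⊆ Set.Icc 0 1)
    (hint : ∀ G : Finset ι, G.Nonempty → G.card ≤ k → ∃ i t, ∀ j ∈ G, t ∈ A j i) :
    ∃ x ∈ Set.Icc (0 : Fin d → ℝ) 1, ∀ j, ∃ i, x i ∈ A j i := by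
  obtain ⟨x, hx, hx'⟩ := (isCompact_Icc (a := (0 : Fin d → ℝ)) (b := 1)).inter_iInter_nonempty
    (fun j => ⋃ i, (fun x : Fin d → ℝ => x i) ⁻¹' A j i)
    (fun j => isClosed_iUnion_of_finite fun i => (hc j i).isClosed.preimage (continuous_apply i))
    (fun u => by
      obtain ⟨x, hx, h⟩ := exists_pierce_of_fintype hk (fun j : u => A j)
        (fun j => hc j) (fun j => hconv j) (fun j => hA j) (fun G hG hGk => by
          obtain ⟨i, t, h⟩ := hint (G.map (Function.Embedding.subtype _)) (hG.map)
            (by rwa [Finset.card_map])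
          exact ⟨i, t, fun j hj => h j (Finset.mem_map_of_mem _ hj)⟩)
      refine ⟨x, hx, ?_⟩
      simp only [Set.mem_iInter, Set.mem_iUnion]
      exact fun j hj => h ⟨j, hj⟩)
  refine ⟨x, hx, fun j => ?_⟩
  simpa using Set.mem_iInter.1 hx' j

/-! ### Transfer to segments in the plane. -/

theorem IsClosedInterval.isCompact {S : Set Plane} (h : IsClosedInterval S) : IsCompact S := by
  rcases h with rfl | ⟨a, b, rfl⟩
  · exact isCompact_empty
  · rw [segment_eq_image_lineMap]
    exact isCompact_Icc.image AffineMap.lineMap_continuous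

theorem IsClosedInterval.convex {S : Set Plane} (h : IsClosedInterval S) : Convex ℝ S := by
  rcases h with rfl | ⟨a, b, rfl⟩
  · exact convex_empty
  · exact convex_segment a b

theorem add_two_le_two_pow_ceil_logb (d : ℕ) : d + 2 ≤ 2 ^ ⌈Real.logb 2 ((d : ℝ) + 2)⌉₊ := by
  have h : (0 : ℝ) < (d : ℝ) + 2 := by positivity
  have := (Real.logb_le_iff_le_rpow one_lt_two h).1 (Nat.le_ceil (Real.logb 2 ((d : ℝ) + 2)))
  rw [Real.rpow_natCast] at this
  exact_mod_cast this

theorem theoremt (d : ℕ) (I : Fin d → Set Plane) (hI : AreParallelUnitSegments I)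
    (F : Set (Set Plane)) (hF : ∀ J ∈ F, IsDInterval I J)
    (hk : ∀ G : Finset (Set Plane), (G : Set (Set Plane)) ⊆ F → G.Nonempty →
      G.card ≤ ⌈Real.logb 2 ((d : ℝ) + 2)⌉₊ → (⋂ J ∈ G, J).Nonempty) :
    ∃ T : Set Plane, IsMultipoint I T ∧ Pierces T F := by
  obtain ⟨u, -, hu⟩ := hI.parallel_unit
  choose p hp using hu
  have hI' : ∀ i, I i = (fun t : ℝ => p i + t • u) '' Set.Icc 0 1 := fun i => by
    rw [hp, segment_eq_image']
    simp
  have hline : ∀ i (S : Set Plane), (fun t : ℝ => p i + t • u) ⁻¹' S =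
      (AffineMap.lineMap (p i) (p i + u) : ℝ →ᵃ[ℝ] Plane) ⁻¹' S := fun i S => by
    ext t
    simp [AffineMap.lineMap_apply, add_comm]
  obtain ⟨x, hx, hxF⟩ := exists_pierce (add_two_le_two_pow_ceil_logb d)
    (fun (J : F) i => Set.Icc 0 1 ∩ (fun t : ℝ => p i + t • u) ⁻¹' (J.1 ∩ I i))
    (fun J i => isCompact_Icc.inter_right
      (((hF J J.2).component i).isCompact.isClosed.preimage (by fun_prop)))
    (fun J i => (convex_Icc 0 1).inter (by
      rw [hline]
      exact ((hF J J.2).component i).convex.affine_preimage _))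
    (fun J i => Set.inter_subset_left)
    (fun G hG hGk => by
      obtain ⟨z, hz⟩ := hk (G.map (Function.Embedding.subtype _))
        (fun J hJ => by
          obtain ⟨J', -, rfl⟩ := Finset.mem_map.1 (Finset.mem_coe.1 hJ)
          exact J'.2) hG.map (by rwa [Finset.card_map])
      have hz' : ∀ J ∈ G, z ∈ J.1 := fun J hJ =>
        Set.mem_iInter₂.1 hz J.1 (Finset.mem_map_of_mem (Function.Embedding.subtype _) hJ)
      obtain ⟨J₀, hJ₀⟩ := hG
      -- The segment containing the common point serves all members of `G` at once.
      obtain ⟨i, hi⟩ := Set.mem_iUnion.1 ((hF J₀ J₀.2).subset_iUnion (hz' J₀ hJ₀))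
      obtain ⟨t, ht, rfl⟩ := (hI' i).subset hi
      exact ⟨i, t, fun J hJ => ⟨ht, hz' J hJ, hi⟩⟩)
  have hmem : ∀ i, p i + x i • u ∈ I i := fun i =>
    (hI' i).superset ⟨x i, ⟨hx.1 i, hx.2 i⟩, rfl⟩
  refine ⟨Set.range fun i => p i + x i • u, ⟨?_, fun i => ?_⟩, fun J hJ => ?_⟩
  · rintro _ ⟨i, rfl⟩
    exact Set.mem_iUnion.2 ⟨i, hmem i⟩
  · refine ⟨p i + x i • u, ⟨⟨i, rfl⟩, hmem i⟩, ?_⟩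
    rintro _ ⟨⟨j, rfl⟩, hj⟩
    by_cases hij : j = i
    · rw [hij]
    · exact (Set.disjoint_left.1 (hI.disjoint j i hij) (hmem j) hj).elim
  · obtain ⟨i, hi⟩ := hxF ⟨J, hJ⟩
    exact ⟨_, hi.2.1, i, rfl⟩
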